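/- **Conventions.** Rings are commutative with unit. Let $I$ be a finite set, $n_I=(n_i)_{i\in I}\in\mathbb N^I$; for each $i\in I$ let $X_i$ and $X_i^*$ be tuples of $n_i+1$ indeterminates, and write $X^*_S=(X^*_i)_{i\in S}$ for $S\subseteq I$. *Splittable forms.* For $n,D\in\mathbb N$ and copies $X_t$ ($t<D$) of $X=(X_0,\dots,X_n)$, put $G_D(X^*)=\prod_{t<D}(X^*\cdot X_t)=\sum_{|\alpha|=D}\sigma_\alpha {X^*}^{\alpha}$, with $\sigma_\alpha\in\mathbb Z[X_t:t<D]$, and $\sigma_D=(\sigma_\alpha)_{|\alpha|=D}$. A form $g=\sum_{|\alpha|=D}a_\alpha {X^*}^\alpha$ of degree $D>0$ over a ring $A$ is *splittable* if $(a_\alpha)_\alpha$ satisfies every polynomial relation over $\mathbb Z$ satisfied by $\sigma_D$. Every form of degree $D=0$ is splittable. *Wedge.* Let $F=\sum_{|\alpha|=d}T^*_\alpha X^\alpha$ be the indeterminate form of degree $d$, let $F\wedge G_D=\prod_{t<D}F(X_t)$, and let $Y$ be a further indeterminate. Let $A$ be a reduced ring, $f\in A[X]$ a form of degree $d$ and $g\in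 A[X^*]$ a splittable form of degree $D$. If there is a ring morphism $\varphi\colon\mathbb Z[T^*,Y,\sigma_D,F\wedge G_D]\to A$ sending $F\mapsto f$ and $YG_D\mapsto g$, then $f\wedge g=\varphi(Y)^d\varphi(F\wedge G_D)\in A$; this does not depend on $\varphi$, and equals $y^d\prod_{t<D} f(x_t)$ when $g=y\prod_{t<D}(X^*\cdot x_t)$ over $A$. If there is no such $\varphi$, put $f\wedge g=0$ (such a $\varphi$ always exists if $A$ is an integrally closed domain). If $R\in A[X^*_I]$ is splittable as a form in $X^*_i$ and $f\in A[X_i]$ is a form, then $f\wedge_i R\in A[X^*_{I\setminus\{i\}}]$ denotes the wedge of $f$ with $R$, viewed as a form in $X_i^*$ over $A[X^*_{I\setminus\{i\}}]$. *Resultants.* Recursively on $|I|$: a polynomial $R\in A[X^*_I]$, homogeneous of a given degree $D_i$ in each $X_i^*$, is a *resultant* in $X^*_I$ over $A$ if for every $i\in I$: (1) $R$ is splittable as a form in $X^*_i$; (2) for every reduced $A$-algebra $B$ and every form $f\in B[X_i]$ of any degree $d$, $f\wedge_i R$ is a resultant in $X^*_{I\setminus\{i\}}$ over $B$ (of degrees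 $dD_j$); (3) moreover, for every $j\in I\setminus\{i\}$ and every form $g\in B[X_j]$, $g\wedge_j f\wedge_i R=f\wedge_i g\wedge_j R$. **Corollary.** Let $i\in I$ and $J=I\setminus\{i\}$. Let $A$ be a unique factorisation domain and let $R\in A[X^*_I]\setminus A[X^*_J]$ be an irreducible resultant over $A$. Let $d\ge 1$ and let $F_i=\sum_{|\alpha|=d}T^*_{i,\alpha}X_i^\alpha$ be an indeterminate form of degree $d$ in $X_i$, where $T^*_i=(T^*_{i,\alpha})_{|\alpha|=d}$. Then $F_i\wedge_i R\in A[T^*_i,X^*_J]$ is irreducible. -/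

import Mathlib

open MvPolynomial

noncomputable section

namespace ResultantWedge

universe u v

/-- The multi-exponents `α ∈ ℕ^(n+1)` with `|α| = d`. -/
abbrev Expo (n d : ℕ) : Type :=
  {α : Fin (n + 1) →₀ ℕ // α ∈ (Finset.univ : Finset (Fin (n + 1))).finsuppAntidiag d}

/-- The indeterminate form `F = ∑_{|α| = d} T_α X^α` of degree `d` in `n + 1` variables, with
coefficients in `A[T]`, `T = (T_α : |α| = d)`. -/
def indetForm (A : Type u) [CommRing A] (n d : ℕ) :
    MvPolynomial (Fin (n + 1)) (MvPolynomial (Expo n d) A) :=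
  ∑ α : Expo n d, monomial α.1 (X α)

/-- `G_D(X*) = ∏_{t < D} (X* · X_t)`, with coefficients in `ℤ[X_t : t < D]`; the variable `(t, j)`
is the `j`-th coordinate of `X_t`. -/
def genericProduct (n D : ℕ) :
    MvPolynomial (Fin (n + 1)) (MvPolynomial (Fin D × Fin (n + 1)) ℤ) :=
  ∏ t : Fin D, ∑ j : Fin (n + 1), C (X (t, j)) * X j

/-- The elementary homogeneous symmetric polynomials `σ_α`, `|α| = D`: the coefficients
of `G_D`. -/
def elemSymm (n D : ℕ) (α : Expo n D) : MvPolynomial (Fin D × Fin (n + 1)) ℤ :=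
  coeff α.1 (genericProduct n D)

/-- `g` is splittable as a form of degree `D`: its coefficients satisfy every polynomial relation
over `ℤ` that the `σ_α` satisfy. Every form of degree `0` is splittable. -/
def IsSplittable {A : Type u} [CommRing A] {n : ℕ} (D : ℕ) (g : MvPolynomial (Fin (n + 1)) A) :
    Prop :=
  g.IsHomogeneous D ∧
    (0 < D → ∀ P : MvPolynomial (Expo n D) ℤ,
      aeval (elemSymm n D) P = 0 → aeval (fun α : Expo n D => coeff α.1 g) P = 0)

/-- Names of the indeterminates `T_α`, `Y` and `X_{t,j}` of the universal wedge. -/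
inductive UVar (n d D : ℕ) : Type
  | T (α : Expo n d) : UVar n d D
  | Y : UVar n d D
  | pt (t : Fin D) (j : Fin (n + 1)) : UVar n d D

/-- The universal wedge `F ∧ G_D = ∏_{t < D} F(X_t)`. -/
def univWedge (n d D : ℕ) : MvPolynomial (UVar n d D) ℤ :=
  ∏ t : Fin D, ∑ α : Expo n d, X (UVar.T α) * ∏ j : Fin (n + 1), X (UVar.pt t j) ^ α.1 j

/-- `σ_α` as a polynomial in the variables `UVar n d D`. -/
def univSymm (n d D : ℕ) (α : Expo n D) : MvPolynomial (UVar n d D) ℤ :=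
  rename (fun v : Fin D × Fin (n + 1) => UVar.pt v.1 v.2) (elemSymm n D α)

/-- The ring `ℤ[T, Y, σ_D, F ∧ G_D]`. The generator `F ∧ G_D` has to be listed: it is symmetric in
the `X_t`, but in general it is not a polynomial in `T` and the `σ_α` with integer coefficients
(for instance for `n = 3`, `D = 2`, `d = 3`). -/
def wedgeRing (n d D : ℕ) : Subalgebra ℤ (MvPolynomial (UVar n d D) ℤ) :=
  Algebra.adjoin ℤ
    (Set.range (fun α : Expo n d => X (UVar.T α)) ∪ {X UVar.Y} ∪ Set.range (univSymm n d D) ∪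
      {univWedge n d D})

/-- `T_α` as an element of `wedgeRing`. -/
def genT (n d D : ℕ) (α : Expo n d) : wedgeRing n d D :=
  ⟨X (UVar.T α), Algebra.subset_adjoin (Or.inl (Or.inl (Or.inl ⟨α, rfl⟩)))⟩

/-- `Y` as an element of `wedgeRing`. -/
def genY (n d D : ℕ) : wedgeRing n d D :=
  ⟨X UVar.Y, Algebra.subset_adjoin (Or.inl (Or.inl (Or.inr rfl)))⟩

/-- `σ_α` as an element of `wedgeRing`. -/
def genS (n d D : ℕ) (α : Expo n D) : wedgeRing n d D :=
  ⟨univSymm n d D α, Algebra.subset_adjoin (Or.inl (Or.inr ⟨α, rfl⟩))⟩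

/-- `F ∧ G_D` as an element of `wedgeRing`. -/
def genW (n d D : ℕ) : wedgeRing n d D :=
  ⟨univWedge n d D, Algebra.subset_adjoin (Or.inr rfl)⟩

/-- `w` is a value of `f ∧ g`, where `f` has degree `d` and `g` has degree `D`: there is a ring
morphism `φ` sending `F` to `f` and `Y G_D` to `g`, and `w = φ(Y)^d φ(F ∧ G_D)`.
If `A` is reduced, there is at most one such `w`. If `g = y ∏ (X* · x_t)` over `A`, then
`y ^ d ∏ f(x_t)` is such a `w`. -/
def IsWedge {A : Type u} [CommRing A] {n : ℕ} (d D : ℕ) (f g : MvPolynomial (Fin (n + 1)) A)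
    (w : A) : Prop :=
  ∃ φ : wedgeRing n d D →+* A,
    (∀ α : Expo n d, φ (genT n d D α) = coeff α.1 f) ∧
    (∀ α : Expo n D, φ (genY n d D * genS n d D α) = coeff α.1 g) ∧
    w = φ (genY n d D) ^ d * φ (genW n d D)

open Classical in
/-- The wedge `f ∧ g ∈ A` of a form `f` of degree `d` and a splittable form `g` of degree `D`
(and `0` if it is not defined). -/
def wedge {A : Type u} [CommRing A] {n : ℕ} (d D : ℕ) (f g : MvPolynomial (Fin (n + 1)) A) : A :=
  if h : ∃ w : A, IsWedge d D f g w then h.choose else 0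

/-- The variables `X*_I = (X*_i : i ∈ I)`, where `X*_i` consists of `n i + 1` variables. -/
abbrev Vars {ι : Type v} (n : ι → ℕ) : Type v := Σ i : ι, Fin (n i + 1)

/-- The restriction of a family to `I \ {i}`. -/
abbrev del {ι : Type v} (n : ι → ℕ) (i : ι) : {j : ι // j ≠ i} → ℕ := fun j => n j.1

/-- The inclusion of the variables `X*_{I \ {i}}` in `X*_I`. -/
def inclVars {ι : Type v} (n : ι → ℕ) (i : ι) : Vars (del n i) → Vars n :=
  fun w => ⟨w.1.1, w.2⟩

open Classical in
/-- A polynomial in `A[X*_I]` regarded as a polynomial in `X*_i` over `A[X*_{I \ {i}}]`. -/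
def splitAt {A : Type u} [CommRing A] {ι : Type v} (n : ι → ℕ) (i : ι) :
    MvPolynomial (Vars n) A →ₐ[A]
      MvPolynomial (Fin (n i + 1)) (MvPolynomial (Vars (del n i)) A) :=
  aeval fun w : Vars n =>
    if h : w.1 = i then X (Fin.cast (by rw [h]) w.2)
    else C (X (⟨⟨w.1, h⟩, w.2⟩ : Vars (del n i)))

/-- The wedge `f ∧_i R ∈ A[X*_{I \ {i}}]` of a form `f ∈ A[X_i]` of degree `d` and of `R ∈ A[X*_I]`,
splittable of degree `D` in `X*_i`. -/
def wedgeAt {A : Type u} [CommRing A] {ι : Type v} (n : ι → ℕ) (i : ι) (d D : ℕ)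
    (f : MvPolynomial (Fin (n i + 1)) A) (R : MvPolynomial (Vars n) A) :
    MvPolynomial (Vars (del n i)) A :=
  wedge d D (map C f) (splitAt n i R)

/-- `R ∈ A[X*_I]` is a resultant in `X*_I` over `A`, homogeneous of degree `D i` in each `X*_i`
(the degrees are recorded since they are not determined by `R` when `R = 0`).
The definition is recursive on the finite set `I`. The algebras `B` range over the reduced
`A`-algebras, where the wedge has at most one value; when `A` is reduced they include the polynomial
rings over `A`, hence the indeterminate forms.
The identity `g ∧_j f ∧_i R = f ∧_i g ∧_j R` is stated in `B[X*_I]`. -/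
inductive IsResultant : ∀ {A : Type u} [CommRing A] {ι : Type v} (n : ι → ℕ) (_ : ι → ℕ)
    (_ : MvPolynomial (Vars n) A), Prop
  | intro {A : Type u} [CommRing A] {ι : Type v} (n D : ι → ℕ) (R : MvPolynomial (Vars n) A)
    (splittable : ∀ i : ι, IsSplittable (D i) (splitAt n i R))
    (wedge_isResultant : ∀ (i : ι) (B : Type u) [CommRing B] [IsReduced B] [Algebra A B] (d : ℕ)
      (f : MvPolynomial (Fin (n i + 1)) B), f.IsHomogeneous d →
        IsResultant (del n i) (fun j => d * D j.1)
          (wedgeAt n i d (D i) f (map (algebraMap A B) R)))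
    (wedge_comm : ∀ (i j : ι) (hji : j ≠ i) (B : Type u) [CommRing B] [IsReduced B] [Algebra A B]
      (d e : ℕ) (f : MvPolynomial (Fin (n i + 1)) B) (g : MvPolynomial (Fin (n j + 1)) B),
        f.IsHomogeneous d → g.IsHomogeneous e →
        rename (inclVars n i ∘ inclVars (del n i) ⟨j, hji⟩)
          (wedgeAt (del n i) ⟨j, hji⟩ e (d * D j) g
            (wedgeAt n i d (D i) f (map (algebraMap A B) R))) =
        rename (inclVars n j ∘ inclVars (del n j) ⟨i, hji.symm⟩)
          (wedgeAt (del n j) ⟨i, hji.symm⟩ d (e * D i) f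
            (wedgeAt n j e (D j) g (map (algebraMap A B) R)))) :
    IsResultant n D R

end ResultantWedge

end

/-!
Over an integrally closed domain the wedge `f ∧ g` is defined: after a base change to an algebraic
closure of the field of fractions, `g = y ∏ (X · x_t)`, and `y ^ d ∏ f(x_t)` is integral by Gauss's
lemma at every valuation ring. It is also rational: Galois invariance handles the separable part
of the extension, and over the purely inseparable part every prime factor of `g` becomes, up to
a scalar, a power of a single linear form.

For the irreducibility, let `r` be `R` as a form in `X*_i`, and write `d = e + 1`. Specialising the
indeterminate form to `(Z · X) ^ e (U · X)` turns `w = F ∧ r` into `r(Z) ^ e r(U)`, where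
`r(U)` is prime. If `w = p q`, then `r(U)` divides the image of one factor, say `p`, so the image
of `q` divides `r(Z) ^ e`, is thus independent of `U`, and so comes from the constant term of `q`
alone. That term is therefore nonzero and divides `r(Z) ^ e`. As `w` is homogeneous in the
coefficients of `F`, so is `q`, which is then equal to its constant term; a constant dividing
`r(Z) ^ e` is a unit because `r` is prime and not constant.
-/

namespace ResultantWedge

section LinForm

variable {σ K L : Type*} [Fintype σ]

/-- The linear form `∑ x_j X_j` with coefficient vector `x`, which the paper writes `X · x`. -/
noncomputable def linForm [CommSemiring K] (x : σ → K) : MvPolynomial σ K :=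
  ∑ j, C (x j) * X j

section CommSemiring

variable [CommSemiring K] [CommSemiring L]

theorem map_linForm (φ : K →+* L) (x : σ → K) : map φ (linForm x) = linForm (φ ∘ x) := by
  simp [linForm]

theorem eval_linForm (x y : σ → K) : eval y (linForm x) = ∑ j, x j * y j := by
  simp [linForm]

theorem coeff_single_linForm (x : σ → K) (j : σ) :
    coeff (Finsupp.single j 1) (linForm x) = x j := by
  classical
  simp [linForm, coeff_sum, coeff_C_mul, coeff_X, Finsupp.single_left_inj]

theorem linForm_injective : Function.Injective (linForm : (σ → K) → MvPolynomial σ K) :=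
  fun x y h => funext fun j => by rw [← coeff_single_linForm x, h, coeff_single_linForm]

theorem linForm_zero : linForm (0 : σ → K) = 0 := by simp [linForm]

theorem linForm_smul (a : K) (x : σ → K) : linForm (a • x) = C a * linForm x := by
  simp [linForm, Finset.mul_sum, mul_assoc]

theorem isHomogeneous_linForm (x : σ → K) : (linForm x).IsHomogeneous 1 :=
  IsHomogeneous.sum _ _ _ fun _ _ => isHomogeneous_C_mul_X _ _

theorem isHomogeneous_linForm_pow_mul_linForm (e : ℕ) (z x : σ → K) :
    (linForm z ^ e * linForm x).IsHomogeneous (e + 1) := by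
  simpa only [one_mul] using ((isHomogeneous_linForm z).pow e).mul (isHomogeneous_linForm x)

theorem linForm_pow_expChar_pow (q : ℕ) [ExpChar K q] (a : ℕ) (x : σ → K) :
    linForm x ^ q ^ a = expand (q ^ a) (linForm fun j => x j ^ q ^ a) := by
  have := expChar_of_injective_ringHom (C_injective σ K) q
  simp [linForm, sum_pow_char_pow, mul_pow]

theorem prod_linForm_eq_sum {τ : Type*} [Fintype τ] [DecidableEq τ] (x : τ → σ → K) :
    ∏ t, linForm (x t) = ∑ j : τ → σ, C (∏ t, x t (j t)) * ∏ t, X (j t) := by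
  simp only [linForm, Finset.prod_univ_sum, Fintype.piFinset_univ, Finset.prod_mul_distrib,
    map_prod]

theorem eval_smul_of_isHomogeneous {τ : Type*} {f : MvPolynomial τ K} {d : ℕ}
    (hf : f.IsHomogeneous d) (a : K) (x : τ → K) : eval (a • x) f = a ^ d * eval x f := by
  rw [eval_eq, eval_eq, Finset.mul_sum]
  refine Finset.sum_congr rfl fun m hm => ?_
  have hdeg : ∑ i ∈ m.support, m i = d := by
    simpa [Finsupp.weight_apply, Finsupp.sum] using hf (mem_support_iff.1 hm)
  simp only [Pi.smul_apply, smul_eq_mul, mul_pow, Finset.prod_mul_distrib,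
    Finset.prod_pow_eq_pow_sum, hdeg]
  ring

end CommSemiring

section Field

variable [Field K]

theorem linForm_ne_zero {x : σ → K} (hx : x ≠ 0) : linForm x ≠ 0 :=
  fun h => hx (linForm_injective (h.trans linForm_zero.symm))

theorem prime_linForm {x : σ → K} (hx : x ≠ 0) : Prime (linForm x) := by
  rw [← UniqueFactorizationMonoid.irreducible_iff_prime]
  refine irreducible_of_totalDegree_eq_one
    ((isHomogeneous_linForm x).totalDegree (linForm_ne_zero hx)) fun a ha => ?_
  obtain ⟨j, hj⟩ := Function.ne_iff.1 hx
  have hdvd : a ∣ x j := coeff_single_linForm x j ▸ ha _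
  exact (ne_zero_of_dvd_ne_zero hj hdvd).isUnit

theorem exists_smul_eq_of_associated_linForm {x y : σ → K}
    (h : Associated (linForm x) (linForm y)) : ∃ a : K, y = a • x := by
  obtain ⟨u, hu⟩ := h
  obtain ⟨a, -, ha⟩ := isUnit_iff_eq_C_of_isReduced.1 u.isUnit
  exact ⟨a, linForm_injective (by rw [linForm_smul, ← ha, ← hu, mul_comm])⟩

end Field

end LinForm

section IsSplitWedge

variable {σ K L : Type*} [Fintype σ] [Field K] [Field L] {d : ℕ} {f g h : MvPolynomial σ K}
  {v w : K}

/-- `g = c ∏ (X · x_t)` is a product of linear forms and `w = c ^ d ∏ f(x_t)`: the description of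
`f ∧ g` by points, for a form `f` of degree `d`. -/
def IsSplitWedge (d : ℕ) (f g : MvPolynomial σ K) (w : K) : Prop :=
  ∃ (c : K) (s : Multiset (σ → K)), g = C c * (s.map linForm).prod ∧
    w = c ^ d * (s.map fun x => eval x f).prod

theorem IsSplitWedge.mul (hg : IsSplitWedge d f g v) (hh : IsSplitWedge d f h w) :
    IsSplitWedge d f (g * h) (v * w) := by
  obtain ⟨c, s, rfl, rfl⟩ := hg
  obtain ⟨c', s', rfl, rfl⟩ := hh
  refine ⟨c * c', s + s', ?_, ?_⟩ <;>
    · simp only [Multiset.map_add, Multiset.prod_add, C_mul]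
      ring

theorem IsSplitWedge.map (φ : K →+* L) (hg : IsSplitWedge d f g w) :
    IsSplitWedge d (MvPolynomial.map φ f) (MvPolynomial.map φ g) (φ w) := by
  obtain ⟨c, s, rfl, rfl⟩ := hg
  refine ⟨φ c, s.map (φ ∘ ·), ?_, ?_⟩
  · simp only [map_mul, map_C, map_multiset_prod, Multiset.map_map, Function.comp_def, map_linForm]
  · simp only [map_mul, map_pow, map_multiset_prod, Multiset.map_map, Function.comp_def, map_eval]

theorem exists_scalar_of_rel_associated_linForm (hf : f.IsHomogeneous d) {s s' : Multiset (σ → K)}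
    (h : Multiset.Rel (fun x y => Associated (linForm x) (linForm y)) s s') :
    ∃ a : K, (s'.map linForm).prod = C a * (s.map linForm).prod ∧
      (s'.map fun x => eval x f).prod = a ^ d * (s.map fun x => eval x f).prod := by
  induction h with
  | zero => exact ⟨1, by simp⟩
  | @cons x y s s' hxy _ ih =>
    obtain ⟨a, hlin, heval⟩ := ih
    obtain ⟨b, rfl⟩ := exists_smul_eq_of_associated_linForm hxy
    refine ⟨b * a, ?_, ?_⟩
    · simp only [Multiset.map_cons, Multiset.prod_cons, hlin, linForm_smul, C_mul]
      ring
    · simp only [Multiset.map_cons, Multiset.prod_cons, heval, eval_smul_of_isHomogeneous hf]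
      ring

theorem ne_zero_of_mem_of_prod_linForm_ne_zero {s : Multiset (σ → K)}
    (hs : (s.map linForm).prod ≠ 0) : ∀ x ∈ s, x ≠ 0 := by
  rintro x hx rfl
  exact hs (Multiset.prod_eq_zero (Multiset.mem_map.2 ⟨0, hx, linForm_zero⟩))

theorem irreducible_of_mem_map_linForm {s : Multiset (σ → K)} (hs : (s.map linForm).prod ≠ 0) :
    ∀ p ∈ s.map linForm, Irreducible p :=
  Multiset.forall_mem_map_iff.2 fun x hx =>
    (prime_linForm (ne_zero_of_mem_of_prod_linForm_ne_zero hs x hx)).irreducible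

theorem IsSplitWedge.unique (hf : f.IsHomogeneous d) (hg : g ≠ 0) (hv : IsSplitWedge d f g v)
    (hw : IsSplitWedge d f g w) : v = w := by
  obtain ⟨c, s, rfl, rfl⟩ := hv
  obtain ⟨c', s', heq, rfl⟩ := hw
  have hs := right_ne_zero_of_mul hg
  have hs' := right_ne_zero_of_mul (heq ▸ hg)
  have hc : IsUnit (C c : MvPolynomial σ K) :=
    (isUnit_iff_ne_zero.2 fun h => hg (by rw [h, C_0, zero_mul])).map C
  have hc' : IsUnit (C c' : MvPolynomial σ K) :=
    (isUnit_iff_ne_zero.2 fun h => hg (by rw [heq, h, C_0, zero_mul])).map C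
  have hassoc : Associated (s.map linForm).prod (s'.map linForm).prod :=
    (associated_unit_mul_right _ _ hc).trans (heq ▸ associated_unit_mul_left _ _ hc')
  have hrel := UniqueFactorizationMonoid.factors_unique (irreducible_of_mem_map_linForm hs)
    (irreducible_of_mem_map_linForm hs') hassoc
  obtain ⟨a, hlin, heval⟩ := exists_scalar_of_rel_associated_linForm hf (Multiset.rel_map.1 hrel)
  rw [hlin, ← mul_assoc, ← C_mul] at heq
  rw [C_injective _ _ (mul_right_cancel₀ hs heq), heval, mul_pow, mul_assoc]

end IsSplitWedge

section Integrality

variable {σ τ : Type*} [Fintype σ] [Fintype τ]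

theorem exists_eq_smul_primitive {σ L : Type*} [Finite σ] [Nonempty σ] [Field L]
    (V : ValuationSubring L) (x : σ → L) :
    ∃ (a : L) (y : σ → V), (∃ j, y j = 1) ∧ x = a • (V.subtype ∘ y) := by
  obtain ⟨j, hj⟩ := Finite.exists_max fun j => V.valuation (x j)
  by_cases hxj : x j = 0
  · have hx : x = 0 := funext fun k => by simpa [hxj] using hj k
    exact ⟨0, fun _ => 1, ⟨j, rfl⟩, by rw [hx, zero_smul]⟩
  · refine ⟨x j, fun k => ⟨x k / x j, ?_⟩, ⟨j, Subtype.ext (div_self hxj)⟩, funext fun k => ?_⟩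
    · rw [← V.valuation_le_one_iff, map_div₀]
      exact div_le_one_of_le₀ (hj k) zero_le
    · exact (mul_div_cancel₀ _ hxj).symm

theorem exists_isUnit_coeff_prod_linForm {V : Type*} [CommRing V] [IsLocalRing V]
    (y : τ → σ → V) (hy : ∀ t, ∃ j, y t j = 1) :
    ∃ m, IsUnit (coeff m (∏ t, linForm (y t))) := by
  have hne : map (IsLocalRing.residue V) (∏ t, linForm (y t)) ≠ 0 := by
    rw [map_prod, Finset.prod_ne_zero_iff]
    intro t _
    rw [map_linForm]
    refine linForm_ne_zero fun h0 => ?_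
    obtain ⟨j, hj⟩ := hy t
    simpa [hj] using congrFun h0 j
  obtain ⟨m, hm⟩ := ne_zero_iff.1 hne
  exact ⟨m, by rwa [coeff_map, IsLocalRing.residue_ne_zero_iff_isUnit] at hm⟩

theorem exists_primitive_of_coeff_mem [Nonempty σ] {L : Type*} [Field L] (V : ValuationSubring L)
    (c : L) (x : τ → σ → L) (h : ∀ m, coeff m (C c * ∏ t, linForm (x t)) ∈ V) :
    ∃ (a : τ → L) (y : τ → σ → V), c * ∏ t, a t ∈ V ∧ ∀ t, x t = a t • (V.subtype ∘ y t) := by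
  choose a y hy hx using fun t => exists_eq_smul_primitive V (x t)
  refine ⟨a, y, ?_, hx⟩
  obtain ⟨m, u, hu⟩ := exists_isUnit_coeff_prod_linForm y hy
  have hprod : C c * ∏ t, linForm (x t) =
      C (c * ∏ t, a t) * map V.subtype (∏ t, linForm (y t)) := by
    simp only [hx, linForm_smul, Finset.prod_mul_distrib, map_prod, map_linForm, C_mul, mul_assoc]
  have hmem := V.mul_mem _ _ (h m) (u⁻¹ : Vˣ).1.2
  rwa [hprod, coeff_C_mul, coeff_map, ← hu, mul_assoc, ValuationSubring.subtype_apply,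
    ← MulMemClass.coe_mul, Units.mul_inv, OneMemClass.coe_one, mul_one] at hmem

theorem isIntegral_of_forall_valuationSubring {R L : Type*} [CommRing R] [Field L] [Algebra R L]
    {x : L} (h : ∀ V : ValuationSubring L, (∀ r, algebraMap R L r ∈ V) → x ∈ V) :
    IsIntegral R x := by
  by_contra hx
  have : IsIntegrallyClosedIn (integralClosure R L).toSubring L :=
    inferInstanceAs (IsIntegrallyClosedIn (integralClosure R L) L)
  obtain ⟨V, hV, hxV⟩ := Subring.exists_le_valuationSubring_of_isIntegrallyClosedIn
    (R := (integralClosure R L).toSubring) (x := x) hx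
  exact hxV (h V fun r => hV ((integralClosure R L).algebraMap_mem r))

-- Gauss's lemma at each valuation ring: the points may be scaled to be primitive, and then the
-- contents of the linear forms absorb the denominators.
theorem isIntegral_pow_mul_prod_eval [Nonempty σ] {R L : Type*} [CommRing R] [Field L]
    [Algebra R L] {d : ℕ} {f : τ → MvPolynomial σ R} (hf : ∀ t, (f t).IsHomogeneous d)
    {g : MvPolynomial σ R} {c : L} {x : τ → σ → L}
    (hg : map (algebraMap R L) g = C c * ∏ t, linForm (x t)) :
    IsIntegral R (c ^ d * ∏ t, eval (x t) (map (algebraMap R L) (f t))) := by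
  refine isIntegral_of_forall_valuationSubring fun V hV => ?_
  obtain ⟨a, y, ha, hx⟩ := exists_primitive_of_coeff_mem V c x fun m => by
    rw [← hg, coeff_map]; exact hV _
  let ρ : R →+* V := (algebraMap R L).codRestrict V.toSubring hV
  have hρ : algebraMap R L = V.subtype.comp ρ := rfl
  have heval (t : τ) : eval (x t) (map (algebraMap R L) (f t)) =
      a t ^ d * V.subtype (eval (y t) (map ρ (f t))) := by
    rw [hx, eval_smul_of_isHomogeneous ((hf t).map _), map_eval, map_map, hρ]
  simp only [heval, Finset.prod_mul_distrib, Finset.prod_pow, ← map_prod, ← mul_assoc, ← mul_pow]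
  exact V.mul_mem _ _ (pow_mem ha d) (SetLike.coe_mem _)

theorem isIntegral_prod_of_map_eq_prod_linForm {S P : Type*} [CommRing S] [CommRing P] [IsDomain P]
    [Algebra S P] {x : τ → σ → P} {g : MvPolynomial σ S}
    (hg : map (algebraMap S P) g = ∏ t, linForm (x t)) (j : τ → σ) :
    IsIntegral S (∏ t, x t (j t)) := by
  cases isEmpty_or_nonempty σ with
  | inl _ =>
    have : IsEmpty τ := Function.isEmpty j
    simpa using isIntegral_one
  | inr _ =>
    let Q := FractionRing P
    have hgQ : map (algebraMap S Q) g = C 1 * ∏ t, linForm (algebraMap P Q ∘ x t) := by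
      simp only [IsScalarTower.algebraMap_eq S P Q, ← map_map, hg, map_prod, map_linForm, C_1,
        one_mul]
    have hint := isIntegral_pow_mul_prod_eval (fun t => isHomogeneous_X S (j t)) hgQ
    rw [← isIntegral_algHom_iff (IsScalarTower.toAlgHom S P Q) (IsFractionRing.injective P Q)]
    simpa using hint

end Integrality

section Specialization

variable {σ τ : Type*} [Fintype σ] [Fintype τ]

theorem exists_ringHom_extension_of_isIntegral {S T L : Type*} [CommRing S] [CommRing T]
    [Algebra S T] [Algebra.IsIntegral S T] [FaithfulSMul S T] [Field L] [IsAlgClosed L]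
    (φ : S →+* L) : ∃ ψ : T →+* L, ψ.comp (algebraMap S T) = φ := by
  have : (RingHom.ker φ).IsPrime := RingHom.ker_isPrime φ
  obtain ⟨Q, -, hQ, hQφ⟩ := Ideal.exists_ideal_over_prime_of_isIntegral (RingHom.ker φ)
    (⊥ : Ideal T) (by simp [← RingHom.ker_eq_comap_bot,
      (RingHom.injective_iff_ker_eq_bot _).1 (FaithfulSMul.algebraMap_injective S T)])
  let p := Q.comap (algebraMap S T)
  let φ' : S ⧸ p →+* L := Ideal.Quotient.lift p φ fun a ha => by
    rwa [← RingHom.mem_ker, ← hQφ]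
  have hφ' : Function.Injective φ' := RingHom.lift_injective_of_ker_le_ideal p _ hQφ.ge
  let _ : Algebra (S ⧸ p) L := φ'.toAlgebra
  have : Module.IsTorsionFree (S ⧸ p) L := Module.isTorsionFree_iff_algebraMap_injective.2 hφ'
  have : Module.IsTorsionFree (S ⧸ p) (T ⧸ Q) :=
    Module.isTorsionFree_iff_algebraMap_injective.2 Ideal.algebraMap_quotient_injective
  let ψ : T ⧸ Q →ₐ[S ⧸ p] L := IsAlgClosed.lift
  exact ⟨ψ.toRingHom.comp (Ideal.Quotient.mk Q),
    RingHom.ext fun s => ψ.commutes (Ideal.Quotient.mk p s)⟩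

theorem prod_prod_erase [DecidableEq τ] {M : Type*} [CommMonoid M] (f : τ → M) :
    ∏ t, ∏ s ∈ Finset.univ.erase t, f s = (∏ t, f t) ^ (Fintype.card τ - 1) := by
  rw [Finset.prod_comm' (t' := Finset.univ) (s' := fun s => Finset.univ.erase s)
    (by simp [eq_comm]), ← Finset.prod_pow]
  exact Finset.prod_congr rfl fun s _ => by simp

-- The points are rescaled by `b t = ∏_{s ≠ t} x s (j₀ s)`, which clears all denominators.
theorem exists_prod_linForm_eq_C_mul {T P : Type*} [CommRing T] [CommRing P] [Algebra T P]
    [FaithfulSMul T P] {x : τ → σ → P} {z : (τ → σ) → T}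
    (hz : ∀ j, algebraMap T P (z j) = ∏ t, x t (j t)) {g : MvPolynomial σ T}
    (hg : map (algebraMap T P) g = ∏ t, linForm (x t)) (j₀ : τ → σ) :
    ∃ y : τ → σ → T, ∏ t, linForm (y t) = C (z j₀ ^ (Fintype.card τ - 1)) * g ∧
      ∀ {d : ℕ} {f : MvPolynomial σ T} {w : T}, f.IsHomogeneous d →
        algebraMap T P w = ∏ t, eval (x t) (map (algebraMap T P) f) →
        ∏ t, eval (y t) f = (z j₀ ^ (Fintype.card τ - 1)) ^ d * w := by
  classical
  have hinj := FaithfulSMul.algebraMap_injective T P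
  let y : τ → σ → T := fun t k => z (Function.update j₀ t k)
  let b : τ → P := fun t => ∏ s ∈ Finset.univ.erase t, x s (j₀ s)
  have hy (t : τ) : algebraMap T P ∘ y t = b t • x t := by
    funext k
    simp only [Function.comp_apply, y, hz, Pi.smul_apply, smul_eq_mul, b,
      ← Finset.prod_erase_mul _ _ (Finset.mem_univ t), Function.update_self]
    congr 1
    exact Finset.prod_congr rfl fun s hs => by
      rw [Function.update_of_ne (Finset.ne_of_mem_erase hs)]
  have hb : algebraMap T P (z j₀ ^ (Fintype.card τ - 1)) = ∏ t, b t := by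
    rw [map_pow, hz, ← prod_prod_erase]
  refine ⟨y, map_injective _ hinj ?_, fun {d f w} hf hw => hinj ?_⟩
  · simp only [map_mul, hg, map_C, hb, map_prod, map_linForm, hy, linForm_smul,
      Finset.prod_mul_distrib]
  · simp only [map_mul, map_pow _ _ d, hw, hb, map_prod, map_eval, hy,
      eval_smul_of_isHomogeneous (hf.map _), Finset.prod_mul_distrib, Finset.prod_pow]

theorem exists_eq_C_mul_prod_linForm_of_ringHom {S P L : Type*} [CommRing S] [CommRing P]
    [IsDomain P] [Algebra S P] [FaithfulSMul S P] [Field L] [IsAlgClosed L] {x : τ → σ → P}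
    {g : MvPolynomial σ S} (hg : map (algebraMap S P) g = ∏ t, linForm (x t)) (φ : S →+* L)
    (h0 : map φ g ≠ 0) :
    ∃ (c : L) (y : τ → σ → L), map φ g = C c * ∏ t, linForm (y t) ∧
      ∀ {d : ℕ} {f : MvPolynomial σ S} {w : S}, f.IsHomogeneous d →
        algebraMap S P w = ∏ t, eval (x t) (map (algebraMap S P) f) →
        φ w = c ^ d * ∏ t, eval (y t) (map φ f) := by
  classical
  let T := integralClosure S P
  let ι := algebraMap S T
  have hι : (algebraMap T P).comp ι = algebraMap S P := (IsScalarTower.algebraMap_eq S T P).symm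
  have : FaithfulSMul S T := (faithfulSMul_iff_algebraMap_injective S T).2 fun a b h =>
    FaithfulSMul.algebraMap_injective S P (congrArg (algebraMap T P) h)
  obtain ⟨ψ, rfl⟩ := exists_ringHom_extension_of_isIntegral (T := T) φ
  let z (j : τ → σ) : T := ⟨∏ t, x t (j t), isIntegral_prod_of_map_eq_prod_linForm hg j⟩
  have hz (j : τ → σ) : algebraMap T P (z j) = ∏ t, x t (j t) := rfl
  have hgT : map (algebraMap T P) (map ι g) = ∏ t, linForm (x t) := by rw [map_map, hι, hg]
  have hsum : map ι g = ∑ j : τ → σ, C (z j) * ∏ t, X (j t) := by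
    refine map_injective _ (FaithfulSMul.algebraMap_injective T P) ?_
    simp only [hgT, prod_linForm_eq_sum, map_sum, map_mul, map_C, hz, map_prod, map_X]
  rw [← map_map] at h0
  obtain ⟨j₀, hj₀⟩ : ∃ j, ψ (z j) ≠ 0 := by
    by_contra! h
    exact h0 (by simp [ι, hsum, h])
  obtain ⟨y, hlin, heval⟩ := exists_prod_linForm_eq_C_mul hz hgT j₀
  set e := Fintype.card τ - 1
  have he : ψ (z j₀ ^ e) ≠ 0 := by rw [map_pow]; exact pow_ne_zero _ hj₀
  refine ⟨(ψ (z j₀ ^ e))⁻¹, fun t => ψ ∘ y t, ?_, fun {d f w} hf hw => ?_⟩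
  · simp only [← map_linForm, ← map_prod, hlin, map_mul, map_C]
    rw [← mul_assoc, ← C_mul, inv_mul_cancel₀ he, C_1, one_mul, map_map]
  · have hwT := congrArg ψ <| heval (f := map ι f) (w := ι w) (hf.map _) <| by
      rw [map_map, hι, ← hw]
      rfl
    simp only [map_mul, map_pow _ _ d, map_prod, map_eval, map_map] at hwT
    rw [hwT, inv_pow, inv_mul_cancel_left₀ (pow_ne_zero d he)]
    rfl

end Specialization

section Rationality

theorem eval_pow_expChar_pow_mem_range {τ R S : Type*} [CommRing R] [CommRing S] [Algebra R S]
    (q : ℕ) [ExpChar S q] {x : τ → S} {a : ℕ} (hx : ∀ j, x j ^ q ^ a ∈ (algebraMap R S).range)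
    (f : MvPolynomial τ R) :
    eval x (map (algebraMap R S) f) ^ q ^ a ∈ (algebraMap R S).range := by
  induction f using MvPolynomial.induction_on with
  | C c => simpa only [map_C, eval_C] using pow_mem (RingHom.mem_range_self _ c) _
  | add p r hp hr => simpa only [map_add, add_pow_expChar_pow] using add_mem hp hr
  | mul_X p j hp => simpa only [map_mul, map_X, eval_X, mul_pow] using mul_mem hp (hx j)

variable {σ E L : Type*} [Field E] [Field L] [Algebra E L]

attribute [local instance] MvPolynomial.algebraMvPolynomial in
theorem dvd_of_map_dvd_map {g h : MvPolynomial σ E}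
    (H : map (algebraMap E L) g ∣ map (algebraMap E L) h) : g ∣ h := by
  have : Module.FaithfullyFlat (MvPolynomial σ E) (MvPolynomial σ L) :=
    .of_linearEquiv _ _
      (Algebra.IsPushout.equiv E (MvPolynomial σ E) L (MvPolynomial σ L)).symm.toLinearEquiv
  rw [← Ideal.mem_span_singleton,
    ← Ideal.comap_map_eq_self_of_faithfullyFlat (B := MvPolynomial σ L) (Ideal.span {g}),
    Ideal.mem_comap, Ideal.map_span, Set.image_singleton, Ideal.mem_span_singleton]
  exact H

theorem exists_eq_expChar_pow_mul (q : ℕ) [ExpChar E q] {b : ℕ} (hb : b ≠ 0) :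
    ∃ a u : ℕ, b = q ^ a * u ∧ (u : E) ≠ 0 := by
  cases ‹ExpChar E q› with
  | zero => exact ⟨0, b, by simp, by exact_mod_cast hb⟩
  | prime hq =>
    obtain ⟨a, u, hu, hbu⟩ := Nat.exists_eq_pow_mul_and_not_dvd hb q hq.ne_one
    exact ⟨a, u, hbu, by rwa [ne_eq, CharP.cast_eq_zero_iff E q]⟩

variable [Fintype σ] {x : σ → L} {j₀ : σ}

theorem pow_expChar_pow_mem_range_of_map_eq_linForm_pow (q : ℕ) [ExpChar E q] {a u : ℕ}
    {P : MvPolynomial σ E} (hj₀ : x j₀ = 1) (hu : (u : E) ≠ 0)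
    (hP : map (algebraMap E L) P = linForm x ^ (q ^ a * u)) (j : σ) :
    x j ^ q ^ a ∈ (algebraMap E L).range := by
  classical
  have := expChar_of_injective_algebraMap (algebraMap E L).injective q
  let y : σ → L := fun j => x j ^ q ^ a
  have hexp : map (algebraMap E L) P = expand (q ^ a) (linForm y ^ u) := by
    rw [hP, pow_mul, linForm_pow_expChar_pow, map_pow]
  obtain ⟨Q, hQ⟩ : linForm y ^ u ∈ Set.range (map (algebraMap E L)) := by
    rw [mem_range_map_iff_coeffs_subset]
    intro c hc
    obtain ⟨m, -, rfl⟩ := mem_coeffs_iff.1 hc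
    refine ⟨coeff (q ^ a • m) P, ?_⟩
    rw [← coeff_map, hexp, coeff_expand_smul _ (pow_ne_zero _ (expChar_ne_zero E q))]
  let e : σ → E := Pi.single j₀ 1
  have he : eval (algebraMap E L ∘ e) (linForm y) = 1 := by
    simp [eval_linForm, e, y, Pi.single_apply, hj₀]
  have hderiv : pderiv j (linForm y) = C (y j) := by
    simp [linForm, Pi.single_apply]
  -- The linear form is `1` at `e`, so there its `u`-th power has partial derivatives `u * y j`.
  have hval : (u : L) * y j = algebraMap E L (eval e (pderiv j Q)) := by
    rw [map_eval, ← pderiv_map, hQ, Derivation.leibniz_pow, hderiv]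
    simp [he]
  refine ⟨(u : E)⁻¹ * eval e (pderiv j Q), ?_⟩
  rw [map_mul, ← hval, ← map_natCast (algebraMap E L), ← mul_assoc, ← map_mul,
    inv_mul_cancel₀ hu, map_one, one_mul]

theorem eval_pow_mem_range_of_map_eq_linForm_pow {b : ℕ} {P : MvPolynomial σ E} (hj₀ : x j₀ = 1)
    (hP : map (algebraMap E L) P = linForm x ^ b) (f : MvPolynomial σ E) :
    eval x (map (algebraMap E L) f) ^ b ∈ (algebraMap E L).range := by
  rcases eq_or_ne b 0 with rfl | hb
  · simpa only [pow_zero] using one_mem _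
  obtain ⟨q, _⟩ := ExpChar.exists E
  have := expChar_of_injective_algebraMap (algebraMap E L).injective q
  obtain ⟨a, u, rfl, hu⟩ := exists_eq_expChar_pow_mul (E := E) q hb
  rw [pow_mul]
  exact pow_mem (eval_pow_expChar_pow_mem_range q
    (pow_expChar_pow_mem_range_of_map_eq_linForm_pow q hj₀ hu hP) f) u

theorem exists_isSplitWedge_of_associated_linForm_pow {d b : ℕ} {P : MvPolynomial σ E}
    (hx : x ≠ 0) (hP : Associated (map (algebraMap E L) P) (linForm x ^ b))
    (f : MvPolynomial σ E) :
    ∃ w : E, IsSplitWedge d (map (algebraMap E L) f) (map (algebraMap E L) P)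
      (algebraMap E L w) := by
  classical
  obtain ⟨j₀, hj₀⟩ := Function.ne_iff.1 hx
  obtain ⟨u, hu⟩ := hP.symm
  obtain ⟨c', -, hc'⟩ := isUnit_iff_eq_C_of_isReduced.1 u.isUnit
  let y : σ → L := (x j₀)⁻¹ • x
  have hy : y j₀ = 1 := inv_mul_cancel₀ hj₀
  have hxy : x = x j₀ • y := (smul_inv_smul₀ hj₀ x).symm
  obtain ⟨c, hc⟩ : ∃ c, map (algebraMap E L) P = C c * linForm y ^ b :=
    ⟨c' * x j₀ ^ b, by rw [← hu, hc', hxy, linForm_smul, ← hxy, C_mul, C_pow]; ring⟩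
  have hcE : algebraMap E L (eval (Pi.single j₀ 1) P) = c := by
    have he : eval (algebraMap E L ∘ Pi.single j₀ 1) (linForm y) = 1 := by
      simp [eval_linForm, Pi.single_apply, hy]
    rw [map_eval, hc, map_mul, eval_C, map_pow, he, one_pow, mul_one]
  have hc0 : c ≠ 0 := by
    rintro rfl
    rw [C_0, zero_mul, ← hu] at hc
    exact mul_ne_zero (pow_ne_zero b (linForm_ne_zero hx)) u.ne_zero hc
  have hmonic : map (algebraMap E L) (C (eval (Pi.single j₀ 1) P)⁻¹ * P) = linForm y ^ b := by
    rw [map_mul, map_C, map_inv₀, hcE, hc, ← mul_assoc, ← C_mul, inv_mul_cancel₀ hc0, C_1,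
      one_mul]
  obtain ⟨v, hv⟩ := eval_pow_mem_range_of_map_eq_linForm_pow hy hmonic f
  refine ⟨eval (Pi.single j₀ 1) P ^ d * v, c, Multiset.replicate b y, ?_, ?_⟩
  · rw [Multiset.map_replicate, Multiset.prod_replicate, hc]
  · rw [Multiset.map_replicate, Multiset.prod_replicate, map_mul, map_pow, hcE, hv]

theorem exists_map_eq_linForm_pow [IsPurelyInseparable E L] (x : σ → L) :
    ∃ N, ∃ H : MvPolynomial σ E, N ≠ 0 ∧ map (algebraMap E L) H = linForm x ^ N := by
  obtain ⟨q, _⟩ := ExpChar.exists E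
  have := expChar_of_injective_algebraMap (algebraMap E L).injective q
  choose a ha using fun j => IsPurelyInseparable.pow_mem E q (x j)
  have hmem : ∀ j, x j ^ q ^ ∑ i, a i ∈ (algebraMap E L).range := fun j => by
    obtain ⟨k, hk⟩ := pow_dvd_pow q (Finset.single_le_sum_of_canonicallyOrdered (f := a)
      (Finset.mem_univ j))
    rw [hk, pow_mul]
    exact pow_mem (ha j) k
  choose y hy using hmem
  refine ⟨q ^ ∑ i, a i, expand (q ^ ∑ i, a i) (linForm y),
    pow_ne_zero _ (expChar_ne_zero E q), ?_⟩
  rw [linForm_pow_expChar_pow, map_expand, map_linForm]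
  exact congrArg _ (congrArg linForm (funext hy))

theorem exists_associated_linForm_pow_of_prime_dvd [IsPurelyInseparable E L]
    {g P : MvPolynomial σ E} {c : L} {s : Multiset (σ → L)} (hg : g ≠ 0)
    (hs : map (algebraMap E L) g = C c * (s.map linForm).prod) (hP : Prime P) (hPg : P ∣ g) :
    ∃ x ≠ 0, ∃ b, Associated (map (algebraMap E L) P) (linForm x ^ b) := by
  choose N H hN hH using exists_map_eq_linForm_pow (E := E) (L := L) (σ := σ)
  have hgL : map (algebraMap E L) g ≠ 0 := by
    rwa [ne_eq, map_eq_zero_iff _ (map_injective _ (algebraMap E L).injective)]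
  have hc : IsUnit (C c : MvPolynomial σ L) :=
    (isUnit_iff_ne_zero.2 fun h => hgL (by rw [hs, h, C_0, zero_mul])).map C
  have hdvd : g ∣ (s.map H).prod := dvd_of_map_dvd_map (L := L) <| by
    rw [hs, hc.mul_left_dvd, map_multiset_prod, Multiset.map_map]
    exact Multiset.prod_dvd_prod_of_dvd _ _ fun x _ =>
      (dvd_pow_self _ (hN x)).trans (hH x).symm.dvd
  obtain ⟨x, hx, hPx⟩ := hP.exists_mem_multiset_map_dvd (hPg.trans hdvd)
  have hx0 := ne_zero_of_mem_of_prod_linForm_ne_zero (right_ne_zero_of_mul (hs ▸ hgL)) x hx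
  obtain ⟨b, -, hb⟩ := (dvd_prime_pow (prime_linForm hx0) (N x)).1
    (hH x ▸ map_dvd (map (algebraMap E L)) hPx)
  exact ⟨x, hx0, b, hb⟩

theorem exists_isSplitWedge_of_isPurelyInseparable [IsPurelyInseparable E L] {d : ℕ}
    {g : MvPolynomial σ E} {c : L} {s : Multiset (σ → L)} (hg : g ≠ 0)
    (hs : map (algebraMap E L) g = C c * (s.map linForm).prod) (f : MvPolynomial σ E) :
    ∃ w : E, IsSplitWedge d (map (algebraMap E L) f) (map (algebraMap E L) g)
      (algebraMap E L w) := by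
  suffices h : ∀ a, a ∣ g → ∃ w : E, IsSplitWedge d (map (algebraMap E L) f)
      (map (algebraMap E L) a) (algebraMap E L w) from h g dvd_rfl
  intro a
  induction a using UniqueFactorizationMonoid.induction_on_prime with
  | h₁ => exact fun h => absurd (zero_dvd_iff.1 h) hg
  | h₂ a ha =>
    obtain ⟨u, -, rfl⟩ := isUnit_iff_eq_C_of_isReduced.1 ha
    exact fun _ => ⟨u ^ d, algebraMap E L u, 0, by simp, by simp⟩
  | h₃ a P _ hP ih =>
    intro hdvd
    obtain ⟨x, hx, b, hb⟩ :=
      exists_associated_linForm_pow_of_prime_dvd hg hs hP (dvd_of_mul_right_dvd hdvd)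
    obtain ⟨v, hv⟩ := exists_isSplitWedge_of_associated_linForm_pow hx hb f
    obtain ⟨w, hw⟩ := ih (dvd_of_mul_left_dvd hdvd)
    exact ⟨v * w, by simpa only [map_mul] using hv.mul hw⟩

end Rationality

theorem mem_range_of_isSplitWedge {σ K L : Type*} [Fintype σ] [Field K] [Field L] [Algebra K L]
    [IsAlgClosed L] [Algebra.IsAlgebraic K L] {d : ℕ} {f g : MvPolynomial σ K}
    (hf : f.IsHomogeneous d) (hg : g ≠ 0) {w : L}
    (hw : IsSplitWedge d (map (algebraMap K L) f) (map (algebraMap K L) g) w) :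
    w ∈ (algebraMap K L).range := by
  let E := separableClosure K L
  have htower : algebraMap K L = (algebraMap E L).comp (algebraMap K E) := rfl
  have hgL : map (algebraMap K L) g ≠ 0 := by
    rwa [ne_eq, map_eq_zero_iff _ (map_injective _ (algebraMap K L).injective)]
  obtain ⟨v, rfl⟩ : ∃ v : E, algebraMap E L v = w := by
    have : IsPurelyInseparable E L := separableClosure.isPurelyInseparable K L
    have hgE : map (algebraMap K E) g ≠ 0 := by
      rwa [ne_eq, map_eq_zero_iff _ (map_injective _ (algebraMap K E).injective)]
    obtain ⟨c, s, hs, -⟩ := id hw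
    rw [htower, ← map_map] at hs
    obtain ⟨v, hv⟩ := exists_isSplitWedge_of_isPurelyInseparable (d := d) hgE hs
      (map (algebraMap K E) f)
    rw [map_map, map_map, ← htower] at hv
    exact ⟨v, hv.unique (hf.map _) hgL hw⟩
  suffices hfix : ∀ ψ : E ≃ₐ[K] E, ψ v = v by
    obtain ⟨a, ha⟩ := (InfiniteGalois.mem_range_algebraMap_iff_fixed v).2 hfix
    exact ⟨a, by rw [htower, RingHom.comp_apply, ha]⟩
  intro ψ
  have : Normal K L := normal_iff.2 fun x =>
    ⟨Algebra.IsIntegral.isIntegral x, IsAlgClosed.splits _⟩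
  have hcomp : (ψ.liftNormal L : L →+* L).comp (algebraMap K L) = algebraMap K L :=
    AlgHom.comp_algebraMap (ψ.liftNormal L : L →ₐ[K] L)
  have hψ := hw.map (ψ.liftNormal L : L →+* L)
  rw [map_map, map_map, hcomp, RingHom.coe_coe, ψ.liftNormal_commutes] at hψ
  exact (algebraMap E L).injective (hψ.unique (hf.map _) hgL hw)

section FormOfCoeffs

variable {K L : Type*} [CommSemiring K] [CommSemiring L] {n D : ℕ}

/-- The form `∑_{|α| = D} a_α X^α` with coefficients `a`. In particular
`indetForm A n D = formOfCoeffs X`. -/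
noncomputable def formOfCoeffs (a : Expo n D → K) : MvPolynomial (Fin (n + 1)) K :=
  ∑ α : Expo n D, monomial α.1 (a α)

theorem mem_finsuppAntidiag_univ_iff_degree {σ : Type*} [Fintype σ] [DecidableEq σ] {m : σ →₀ ℕ} :
    m ∈ (Finset.univ : Finset σ).finsuppAntidiag D ↔ m.degree = D := by
  simp [Finset.mem_finsuppAntidiag, Finsupp.degree_eq_sum]

theorem isHomogeneous_formOfCoeffs (a : Expo n D → K) : (formOfCoeffs a).IsHomogeneous D :=
  IsHomogeneous.sum _ _ _ fun α _ =>
    isHomogeneous_monomial _ (mem_finsuppAntidiag_univ_iff_degree.1 α.2)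

theorem coeff_formOfCoeffs (a : Expo n D → K) (β : Expo n D) :
    coeff β.1 (formOfCoeffs a) = a β := by
  classical
  simp [formOfCoeffs, coeff_sum, coeff_monomial]

theorem formOfCoeffs_coeff {f : MvPolynomial (Fin (n + 1)) K} (hf : f.IsHomogeneous D) :
    formOfCoeffs (fun α : Expo n D => coeff α.1 f) = f := by
  ext m
  by_cases hm : m.degree = D
  · exact coeff_formOfCoeffs _ ⟨m, mem_finsuppAntidiag_univ_iff_degree.2 hm⟩
  · rw [(isHomogeneous_formOfCoeffs _).coeff_eq_zero hm, hf.coeff_eq_zero hm]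

theorem map_formOfCoeffs (φ : K →+* L) (a : Expo n D → K) :
    map φ (formOfCoeffs a) = formOfCoeffs (φ ∘ a) := by
  simp [formOfCoeffs]

theorem formOfCoeffs_const_mul (c : K) (a : Expo n D → K) :
    formOfCoeffs (fun α => c * a α) = C c * formOfCoeffs a := by
  simp [formOfCoeffs, Finset.mul_sum, C_mul_monomial]

theorem isHomogeneous_prod_linForm {σ τ : Type*} [Fintype σ] [Fintype τ] (x : τ → σ → K) :
    (∏ t, linForm (x t)).IsHomogeneous (Fintype.card τ) := by
  simpa using IsHomogeneous.prod Finset.univ _ (fun _ => 1) fun t _ => isHomogeneous_linForm (x t)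

end FormOfCoeffs

section Wedge

variable {n d D : ℕ}

theorem formOfCoeffs_elemSymm :
    formOfCoeffs (elemSymm n D) = ∏ t, linForm fun j => X (t, j) :=
  formOfCoeffs_coeff (f := ∏ t, linForm fun j => X (t, j)) <| by
    simpa only [Fintype.card_fin] using
      isHomogeneous_prod_linForm fun (t : Fin D) (j : Fin (n + 1)) => X (R := ℤ) (t, j)

theorem formOfCoeffs_univSymm :
    formOfCoeffs (univSymm n d D) = ∏ t, linForm fun j => X (UVar.pt t j) := by
  have h := map_formOfCoeffs (rename (R := ℤ) fun v : Fin D × Fin (n + 1) =>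
    (UVar.pt v.1 v.2 : UVar n d D)).toRingHom (elemSymm n D)
  refine h.symm.trans ?_
  simp only [formOfCoeffs_elemSymm, map_prod, map_linForm]
  simp [Function.comp_def]

theorem univWedge_eq_prod_eval : univWedge n d D =
    ∏ t, eval (fun j => X (UVar.pt t j)) (formOfCoeffs fun α => X (UVar.T α)) := by
  simp only [univWedge, formOfCoeffs, map_sum, eval_monomial, Finsupp.prod_fintype, pow_zero,
    implies_true]

section CommRing

variable {A B : Type*} [CommRing A] [CommRing B] {f g : MvPolynomial (Fin (n + 1)) A} {w : A}

theorem IsWedge.map (h : IsWedge d D f g w) (ψ : A →+* B) :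
    IsWedge d D (MvPolynomial.map ψ f) (MvPolynomial.map ψ g) (ψ w) := by
  obtain ⟨φ, hT, hS, rfl⟩ := h
  exact ⟨ψ.comp φ, fun α => by rw [coeff_map, ← hT]; rfl, fun α => by rw [coeff_map, ← hS]; rfl,
    by simp⟩

theorem IsSplittable.map (h : IsSplittable D g) (ψ : A →+* B) :
    IsSplittable D (MvPolynomial.map ψ g) := by
  refine ⟨h.1.map ψ, fun hD P hP => ?_⟩
  have h0 := congrArg ψ (h.2 hD P hP)
  rw [map_zero, ← RingHom.toIntAlgHom_apply, comp_aeval_apply] at h0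
  simpa only [coeff_map, RingHom.toIntAlgHom_apply] using h0

end CommRing

theorem IsWedge.isSplitWedge {L : Type*} [Field L] [IsAlgClosed L]
    {f g : MvPolynomial (Fin (n + 1)) L} {w : L} (h : IsWedge d D f g w)
    (hf : f.IsHomogeneous d) (hg : g.IsHomogeneous D) (hg0 : g ≠ 0) : IsSplitWedge d f g w := by
  obtain ⟨φ, hT, hS, rfl⟩ := h
  have hF : MvPolynomial.map φ (formOfCoeffs (genT n d D)) = f := by
    rw [map_formOfCoeffs, ← formOfCoeffs_coeff hf]
    exact congrArg _ (funext hT)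
  have hG : g = C (φ (genY n d D)) * MvPolynomial.map φ (formOfCoeffs (genS n d D)) := by
    rw [map_formOfCoeffs, ← formOfCoeffs_const_mul, ← formOfCoeffs_coeff hg]
    exact congrArg _ (funext fun α => by rw [← hS, map_mul]; rfl)
  let ι := algebraMap (wedgeRing n d D) (MvPolynomial (UVar n d D) ℤ)
  have hsymm : MvPolynomial.map ι (formOfCoeffs (genS n d D)) =
      ∏ t, linForm fun j => X (UVar.pt t j) := by
    rw [map_formOfCoeffs, ← formOfCoeffs_univSymm]
    rfl
  have hwedge : ι (genW n d D) =
      ∏ t, eval (fun j => X (UVar.pt t j))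
        (MvPolynomial.map ι (formOfCoeffs (genT n d D))) := by
    rw [map_formOfCoeffs]
    exact univWedge_eq_prod_eval
  obtain ⟨c, y, hlin, heval⟩ := exists_eq_C_mul_prod_linForm_of_ringHom hsymm φ
    (right_ne_zero_of_mul (hG ▸ hg0))
  refine ⟨φ (genY n d D) * c, Finset.univ.val.map y, ?_, ?_⟩
  · rw [hG, hlin, C_mul, mul_assoc, Multiset.map_map]
    rfl
  · rw [heval (isHomogeneous_formOfCoeffs _) hwedge, hF, Multiset.map_map, mul_pow, mul_assoc]
    rfl

theorem exists_algHom_range_aeval {R P A τ : Type*} [CommRing R] [CommRing P] [CommRing A]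
    [Algebra R P] [Algebra R A] {x : τ → P} {a : τ → A}
    (h : ∀ p : MvPolynomial τ R, aeval x p = 0 → aeval a p = 0) :
    ∃ φ : (aeval (R := R) x).range →ₐ[R] A,
      ∀ t, φ ((aeval (R := R) x).rangeRestrict (X t)) = a t := by
  let e := (aeval (R := R) x).rangeRestrict
  have he : Function.Surjective e := (aeval x).rangeRestrict_surjective
  have hker : RingHom.ker e.toRingHom ≤ RingHom.ker (aeval (R := R) a).toRingHom :=
    fun p hp => h p (congrArg Subtype.val hp)
  exact ⟨AlgHom.liftOfSurjective e he (aeval a) hker,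
    fun t => (AlgHom.liftOfSurjective_apply e he (aeval a) hker (X t)).trans (aeval_X _ _)⟩

theorem exists_C_mul_prod_linForm_eq {σ L : Type*} [Fintype σ] [CommSemiring L] (hD : 0 < D)
    (c : L) (y : Fin D → σ → L) :
    ∃ z : Fin D → σ → L, C c * ∏ t, linForm (y t) = ∏ t, linForm (z t) := by
  obtain ⟨D, rfl⟩ := Nat.exists_eq_succ_of_ne_zero hD.ne'
  exact ⟨Fin.cons (c • y 0) fun t => y t.succ, by
    simp [Fin.prod_univ_succ, linForm_smul, mul_assoc]⟩

theorem IsSplittable.exists_eq_prod_linForm {L : Type*} [Field L] [IsAlgClosed L] (hD : 0 < D)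
    {g : MvPolynomial (Fin (n + 1)) L} (hg : IsSplittable D g) (hg0 : g ≠ 0) :
    ∃ y : Fin D → Fin (n + 1) → L, g = ∏ t, linForm (y t) := by
  obtain ⟨φ, hφ⟩ := exists_algHom_range_aeval (hg.2 hD)
  let e := (aeval (R := ℤ) (elemSymm n D)).rangeRestrict
  have hsymm : MvPolynomial.map (algebraMap (aeval (R := ℤ) (elemSymm n D)).range
      (MvPolynomial (Fin D × Fin (n + 1)) ℤ)) (formOfCoeffs fun α => e (X α)) =
      ∏ t, linForm fun j => X (t, j) := by
    rw [map_formOfCoeffs, ← formOfCoeffs_elemSymm]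
    exact congrArg _ (funext fun α => aeval_X _ _)
  have hG : MvPolynomial.map φ.toRingHom (formOfCoeffs fun α => e (X α)) = g := by
    rw [map_formOfCoeffs, ← formOfCoeffs_coeff hg.1]
    exact congrArg _ (funext hφ)
  obtain ⟨c, y, hc, -⟩ := exists_eq_C_mul_prod_linForm_of_ringHom hsymm φ.toRingHom (by rwa [hG])
  rw [hG] at hc
  exact hc ▸ exists_C_mul_prod_linForm_eq hD c y

theorem exists_ringHom_of_forall_mem_range {S A L : Type*} [Ring S] [Ring A] [Ring L]
    {i : A →+* L} (hi : Function.Injective i) (Φ : S →+* L) (h : ∀ s, Φ s ∈ i.range) :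
    ∃ φ : S →+* A, ∀ s, i (φ s) = Φ s := by
  let e : A ≃+* i.range := .ofBijective i.rangeRestrict
    ⟨fun a b hab => hi (congrArg Subtype.val hab), i.rangeRestrict_surjective⟩
  exact ⟨(e.symm : i.range →+* A).comp (Φ.codRestrict _ h),
    fun s => congrArg Subtype.val (e.apply_symm_apply ⟨Φ s, h s⟩)⟩

/-- The point of `L`-space with coordinates the coefficients of `f`, the scalar `c` and the points
`y_t`; evaluation there is the morphism `ℤ[T, Y, X_t] → L` with `F ↦ f`, `Y ↦ c` and
`X_t ↦ y_t`. -/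
noncomputable def uvarPoint {L : Type*} [CommSemiring L] (f : MvPolynomial (Fin (n + 1)) L) (c : L)
    (y : Fin D → Fin (n + 1) → L) : UVar n d D → L
  | .T α => coeff α.1 f
  | .Y => c
  | .pt t j => y t j

section UvarPoint

variable {L : Type*} [CommRing L] (f : MvPolynomial (Fin (n + 1)) L) (c : L)
  (y : Fin D → Fin (n + 1) → L)

theorem aeval_uvarPoint_univSymm (α : Expo n D) :
    aeval (uvarPoint (d := d) f c y) (univSymm n d D α) = coeff α.1 (∏ t, linForm (y t)) := by
  rw [← coeff_formOfCoeffs (univSymm n d D) α, formOfCoeffs_univSymm, ← RingHom.coe_coe,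
    ← coeff_map, map_prod]
  simp [map_linForm, Function.comp_def, uvarPoint]

theorem aeval_uvarPoint_univWedge {f : MvPolynomial (Fin (n + 1)) L} (hf : f.IsHomogeneous d) :
    aeval (uvarPoint f c y) (univWedge n d D) = ∏ t, eval (y t) f := by
  rw [univWedge_eq_prod_eval, map_prod]
  refine Finset.prod_congr rfl fun t _ => ?_
  rw [← RingHom.coe_coe, map_eval, map_formOfCoeffs]
  conv_rhs => rw [← formOfCoeffs_coeff hf]
  simp [Function.comp_def, uvarPoint]

end UvarPoint

theorem exists_isWedge_of_points {A L : Type*} [CommRing A] [CommRing L] {i : A →+* L}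
    (hi : Function.Injective i) {f g h : MvPolynomial (Fin (n + 1)) A} (hf : f.IsHomogeneous d)
    {c : A} (hg : g = C c * h) {y : Fin D → Fin (n + 1) → L}
    (hy : MvPolynomial.map i h = ∏ t, linForm (y t))
    (hw : ∏ t, eval (y t) (MvPolynomial.map i f) ∈ i.range) : ∃ w, IsWedge d D f g w := by
  let Φ : MvPolynomial (UVar n d D) ℤ →ₐ[ℤ] L := aeval (uvarPoint (MvPolynomial.map i f) (i c) y)
  have hT (α : Expo n d) : Φ (X (UVar.T α)) = i (coeff α.1 f) := by
    rw [aeval_X, uvarPoint, coeff_map]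
  have hY : Φ (X UVar.Y) = i c := aeval_X _ _
  have hS (α : Expo n D) : Φ (univSymm n d D α) = i (coeff α.1 h) := by
    rw [aeval_uvarPoint_univSymm, ← hy, coeff_map]
  have hle : wedgeRing n d D ≤ (subalgebraOfSubring i.range).comap Φ := by
    refine Algebra.adjoin_le ?_
    rintro _ (((⟨α, rfl⟩ | rfl) | ⟨α, rfl⟩) | rfl)
    · exact ⟨_, (hT α).symm⟩
    · exact ⟨_, hY.symm⟩
    · exact ⟨_, (hS α).symm⟩
    · change Φ _ ∈ i.range
      rwa [aeval_uvarPoint_univWedge _ _ (hf.map i)]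
  obtain ⟨φ, hφ⟩ := exists_ringHom_of_forall_mem_range hi
    (Φ.comp (wedgeRing n d D).val).toRingHom fun s => hle s.2
  refine ⟨_, φ, fun α => hi ((hφ _).trans (hT α)), fun α => hi ?_, rfl⟩
  rw [map_mul, map_mul, hφ, hφ, hg, coeff_C_mul, map_mul]
  exact congrArg₂ _ hY (hS α)

theorem IsSplittable.exists_eq_C_mul_of_isAlgClosed {A L : Type*} [CommRing A] [Field L]
    [IsAlgClosed L] {i : A →+* L} (hi : Function.Injective i) {g : MvPolynomial (Fin (n + 1)) A}
    (hg : IsSplittable D g) (hg0 : g ≠ 0) :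
    ∃ (c : A) (h : MvPolynomial (Fin (n + 1)) A) (y : Fin D → Fin (n + 1) → L),
      g = C c * h ∧ MvPolynomial.map i h = ∏ t, linForm (y t) := by
  rcases D.eq_zero_or_pos with rfl | hD
  · refine ⟨coeff 0 g, 1, 0, ?_, by simp⟩
    rw [mul_one]
    exact totalDegree_eq_zero_iff_eq_C.1 (hg.1.totalDegree hg0)
  · obtain ⟨y, hy⟩ := (hg.map i).exists_eq_prod_linForm hD
      ((map_ne_zero_iff _ (map_injective _ hi)).2 hg0)
    exact ⟨1, g, y, by rw [C_1, one_mul], hy⟩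

theorem algebraMap_algebraicClosure_fractionRing_injective (A : Type*) [CommRing A] [IsDomain A] :
    Function.Injective (algebraMap A (AlgebraicClosure (FractionRing A))) := by
  rw [IsScalarTower.algebraMap_eq A (FractionRing A)]
  exact (algebraMap (FractionRing A) _).injective.comp (IsFractionRing.injective A _)

theorem exists_isWedge {A : Type*} [CommRing A] [IsDomain A] [IsIntegrallyClosed A]
    {f g : MvPolynomial (Fin (n + 1)) A} (hf : f.IsHomogeneous d) (hg : IsSplittable D g)
    (hg0 : g ≠ 0) : ∃ w, IsWedge d D f g w := by
  let K := FractionRing A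
  let L := AlgebraicClosure K
  have hK : Function.Injective (algebraMap A K) := IsFractionRing.injective A K
  have hL : Function.Injective (algebraMap A L) :=
    algebraMap_algebraicClosure_fractionRing_injective A
  obtain ⟨c, h, y, rfl, hy⟩ := hg.exists_eq_C_mul_of_isAlgClosed hL hg0
  refine exists_isWedge_of_points hL hf rfl hy ?_
  have hintegral : IsIntegral A (∏ t, eval (y t) (MvPolynomial.map (algebraMap A L) f)) := by
    simpa only [one_pow, one_mul] using isIntegral_pow_mul_prod_eval (L := L) (c := 1)
      (fun _ => hf) (by rw [hy, C_1, one_mul])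
  have hrational : ∏ t, eval (y t) (MvPolynomial.map (algebraMap A L) f) ∈
      (algebraMap K L).range := by
    refine mem_range_of_isSplitWedge (hf.map (algebraMap A K))
      (g := MvPolynomial.map (algebraMap A K) h)
      ((map_ne_zero_iff _ (map_injective _ hK)).2 (right_ne_zero_of_mul hg0)) ?_
    rw [map_map, map_map, ← IsScalarTower.algebraMap_eq]
    refine ⟨1, Finset.univ.val.map y, ?_, ?_⟩
    · rw [hy, C_1, one_mul, Multiset.map_map]
      rfl
    · rw [one_pow, one_mul, Multiset.map_map]
      rfl
  obtain ⟨k, hk⟩ := hrational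
  rw [← hk, isIntegral_algebraMap_iff (algebraMap K L).injective] at hintegral
  obtain ⟨a, ha⟩ := IsIntegrallyClosed.isIntegral_iff.1 hintegral
  exact ⟨a, by rw [IsScalarTower.algebraMap_apply A K L, ha, hk]⟩

theorem card_eq_of_isHomogeneous_prod_linForm {σ K : Type*} [Fintype σ] [CommRing K] [IsDomain K]
    {c : K} {s : Multiset (σ → K)} (h : (C c * (s.map linForm).prod).IsHomogeneous D)
    (h0 : C c * (s.map linForm).prod ≠ 0) : s.card = D := by
  have hs : (s.map linForm).prod.IsHomogeneous s.card := by
    clear h h0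
    induction s using Multiset.induction with
    | empty => simpa using isHomogeneous_one _ _
    | cons x s ih =>
      rw [Multiset.map_cons, Multiset.prod_cons, Multiset.card_cons, add_comm]
      exact (isHomogeneous_linForm x).mul ih
  exact (hs.C_mul c).inj_right h h0

section SplitWedge

variable {σ K : Type*} [Fintype σ] [Field K] {f g : MvPolynomial σ K} {w : K}

theorem IsSplitWedge.C_mul_left (hg : g.IsHomogeneous D) (hg0 : g ≠ 0)
    (h : IsSplitWedge d f g w) (a : K) : IsSplitWedge d (C a * f) g (a ^ D * w) := by
  obtain ⟨c, s, rfl, rfl⟩ := h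
  refine ⟨c, s, rfl, ?_⟩
  simp only [map_mul, eval_C, Multiset.prod_map_mul, Multiset.map_const', Multiset.prod_replicate,
    card_eq_of_isHomogeneous_prod_linForm hg hg0]
  ring

theorem IsSplitWedge.eq_of_linForm {e : ℕ} {z x : σ → K}
    (h : IsSplitWedge (e + 1) (linForm z ^ e * linForm x) g w) :
    w = eval z g ^ e * eval x g := by
  obtain ⟨c, s, rfl, rfl⟩ := h
  have heval (v : σ → K) : eval v (C c * (s.map linForm).prod) =
      c * (s.map fun y => eval y (linForm v)).prod := by
    simp only [map_mul, eval_C, map_multiset_prod, Multiset.map_map, Function.comp_def,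
      eval_linForm, mul_comm]
  simp only [heval, map_mul, map_pow, Multiset.prod_map_mul, Multiset.prod_map_pow]
  ring

end SplitWedge

theorem IsWedge.isSplitWedge_map {B L : Type*} [CommRing B] [Field L] [IsAlgClosed L]
    {f g : MvPolynomial (Fin (n + 1)) B} {w : B} (h : IsWedge d D f g w) (hf : f.IsHomogeneous d)
    (hg : g.IsHomogeneous D) (hg0 : g ≠ 0) {i : B →+* L} (hi : Function.Injective i) :
    IsSplitWedge d (MvPolynomial.map i f) (MvPolynomial.map i g) (i w) :=
  (h.map i).isSplitWedge (hf.map i) (hg.map i) ((map_ne_zero_iff _ (map_injective _ hi)).2 hg0)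

section IsDomain

variable {B : Type*} [CommRing B] [IsDomain B] {f g : MvPolynomial (Fin (n + 1)) B} {w w' : B}

theorem IsWedge.eq_pow_mul_of_C_mul (h : IsWedge d D f g w) {a : B}
    (h' : IsWedge d D (C a * f) g w') (hf : f.IsHomogeneous d) (hg : g.IsHomogeneous D)
    (hg0 : g ≠ 0) : w' = a ^ D * w := by
  let i := algebraMap B (AlgebraicClosure (FractionRing B))
  have hi : Function.Injective i := algebraMap_algebraicClosure_fractionRing_injective B
  have hg0' : MvPolynomial.map i g ≠ 0 := (map_ne_zero_iff _ (map_injective _ hi)).2 hg0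
  have hscaled := h'.isSplitWedge_map (hf.C_mul a) hg hg0 hi
  rw [map_mul, map_C] at hscaled
  refine hi (hscaled.unique ((hf.map i).C_mul _) hg0' ?_)
  rw [map_mul, map_pow]
  exact (h.isSplitWedge_map hf hg hg0 hi).C_mul_left (hg.map i) hg0' _

theorem IsWedge.eq_of_linForm {e : ℕ} {z x : Fin (n + 1) → B}
    (h : IsWedge (e + 1) D (linForm z ^ e * linForm x) g w) (hg : g.IsHomogeneous D)
    (hg0 : g ≠ 0) : w = eval z g ^ e * eval x g := by
  let i := algebraMap B (AlgebraicClosure (FractionRing B))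
  have hi : Function.Injective i := algebraMap_algebraicClosure_fractionRing_injective B
  have hsplit := h.isSplitWedge_map (isHomogeneous_linForm_pow_mul_linForm e z x) hg hg0 hi
  rw [map_mul, map_pow, map_linForm, map_linForm] at hsplit
  apply hi
  rw [hsplit.eq_of_linForm, map_mul, map_pow, map_eval, map_eval]

end IsDomain

end Wedge

section Divisibility

variable {σ τ A : Type*} [CommRing A]

theorem exists_eq_C_of_dvd_C [IsDomain A] {p : MvPolynomial σ A} {a : A} (ha : a ≠ 0)
    (h : p ∣ C a) : ∃ b, b ∣ a ∧ p = C b := by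
  obtain ⟨q, hq⟩ := h
  have hpq : p * q ≠ 0 := hq ▸ C_ne_zero.2 ha
  have hdeg := totalDegree_mul_of_isDomain (left_ne_zero_of_mul hpq) (right_ne_zero_of_mul hpq)
  rw [← hq, totalDegree_C, eq_comm, Nat.add_eq_zero_iff] at hdeg
  have hp := totalDegree_eq_zero_iff_eq_C.1 hdeg.1
  have hq' := totalDegree_eq_zero_iff_eq_C.1 hdeg.2
  exact ⟨coeff 0 p, ⟨coeff 0 q, C_injective σ A (by rw [C_mul, ← hp, ← hq', hq])⟩, hp⟩

theorem isUnit_of_C_dvd_prime_pow [IsDomain A] {r : MvPolynomial σ A} (hr : Prime r)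
    (hrC : ∀ a, r ≠ C a) {a : A} {e : ℕ} (h : C a ∣ r ^ e) : IsUnit a := by
  obtain ⟨k, -, hk⟩ := (dvd_prime_pow hr e).1 h
  rcases k with _ | k
  · rw [pow_zero, associated_one_iff_isUnit] at hk
    obtain ⟨b, hb, hab⟩ := isUnit_iff_eq_C_of_isReduced.1 hk
    rwa [C_injective σ A hab]
  · have ha : a ≠ 0 := C_ne_zero.1 (ne_zero_of_dvd_ne_zero (pow_ne_zero e hr.ne_zero) h)
    obtain ⟨b, -, hb⟩ := exists_eq_C_of_dvd_C ha ((dvd_pow_self r k.succ_ne_zero).trans hk.dvd')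
    exact absurd hb (hrC b)

theorem prime_map_C {r : MvPolynomial σ A} (hr : Prime r) :
    Prime (map (C : A →+* MvPolynomial τ A) r) := by
  rwa [← commAlgEquiv_C, MulEquiv.prime_iff, prime_C_iff]

theorem eq_C_of_mul_eq_X_pow_mul_C [IsDomain A] {p q : Polynomial A} {D : ℕ} {w : A} (hw : w ≠ 0)
    (h : p * q = Polynomial.X ^ D * Polynomial.C w) (hq0 : q.coeff 0 ≠ 0) :
    q = Polynomial.C (q.coeff 0) := by
  have hpq : p * q ≠ 0 :=
    h ▸ mul_ne_zero (pow_ne_zero _ Polynomial.X_ne_zero) (Polynomial.C_ne_zero.2 hw)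
  have hp := left_ne_zero_of_mul hpq
  have hq := right_ne_zero_of_mul hpq
  have hdeg : p.natDegree + q.natDegree = D := by
    rw [← Polynomial.natDegree_mul hp hq, h, mul_comm, Polynomial.natDegree_C_mul_X_pow _ _ hw]
  have htrailing : p.natTrailingDegree + q.natTrailingDegree = D := by
    rw [← Polynomial.natTrailingDegree_mul hp hq, h, mul_comm,
      Polynomial.C_mul_X_pow_eq_monomial, Polynomial.natTrailingDegree_monomial hw]
  have hq' := Polynomial.natTrailingDegree_le_of_ne_zero hq0
  have hp' := Polynomial.natTrailingDegree_le_natDegree p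
  exact Polynomial.eq_C_of_natDegree_eq_zero (by omega)

end Divisibility

section ScaleVars

variable {τ B : Type*} [CommRing B]

/-- The morphism `B[T] → B[T][s]` over `B` multiplying every variable by `s`; a polynomial `p` is
homogeneous of degree `D` exactly when it is sent to `s ^ D p`. -/
noncomputable def scaleVars : MvPolynomial τ B →+* Polynomial (MvPolynomial τ B) :=
  eval₂Hom (Polynomial.C.comp C) fun t => Polynomial.X * Polynomial.C (X t)

theorem coeff_zero_scaleVars (p : MvPolynomial τ B) :
    (scaleVars p).coeff 0 = C (constantCoeff p) := by
  have h : Polynomial.constantCoeff.comp scaleVars = C.comp (constantCoeff (σ := τ) (R := B)) := by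
    ext <;> simp [scaleVars]
  exact RingHom.congr_fun h p

theorem eval_one_scaleVars (p : MvPolynomial τ B) : (scaleVars p).eval 1 = p := by
  have h : (Polynomial.evalRingHom 1).comp scaleVars = RingHom.id (MvPolynomial τ B) := by
    ext <;> simp [scaleVars]
  exact RingHom.congr_fun h p

theorem eq_C_constantCoeff_of_scaleVars_mul [IsDomain B] {p q : MvPolynomial τ B} {D : ℕ}
    (hpq : p * q ≠ 0) (h : scaleVars (p * q) = Polynomial.X ^ D * Polynomial.C (p * q))
    (hq : constantCoeff q ≠ 0) : q = C (constantCoeff q) := by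
  rw [map_mul] at h
  have hconst := eq_C_of_mul_eq_X_pow_mul_C hpq h (by rwa [coeff_zero_scaleVars, C_ne_zero])
  rw [coeff_zero_scaleVars] at hconst
  rw [← eval_one_scaleVars q, hconst, Polynomial.eval_C, constantCoeff_C]

end ScaleVars

section IndetForm

variable {B : Type*} [CommRing B] {n d D e : ℕ} {r : MvPolynomial (Fin (n + 1)) B}

theorem isHomogeneous_indetForm (B : Type*) [CommRing B] (n d : ℕ) :
    (indetForm B n d).IsHomogeneous d :=
  isHomogeneous_formOfCoeffs _

theorem map_eval₂Hom_indetForm {E : Type*} [CommRing E] (κ : B →+* E)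
    {f : MvPolynomial (Fin (n + 1)) E} (hf : f.IsHomogeneous d) :
    map (eval₂Hom κ fun α : Expo n d => coeff α.1 f) (indetForm B n d) = f := by
  refine (map_formOfCoeffs _ _).trans (Eq.trans (congrArg _ (funext fun α => ?_))
    (formOfCoeffs_coeff hf))
  exact eval₂Hom_X' _ _ _

theorem map_eval₂Hom_map_C {σ τ E : Type*} [CommRing E] (κ : B →+* E) (a : τ → E)
    (p : MvPolynomial σ B) : map (eval₂Hom κ a) (map C p) = map κ p := by
  rw [map_map, eval₂Hom_comp_C]

theorem IsWedge.eval₂Hom_linForm_pow_mul_linForm {E : Type*} [CommRing E] [IsDomain E]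
    {w : MvPolynomial (Expo n (e + 1)) B}
    (hw : IsWedge (e + 1) D (indetForm B n (e + 1)) (MvPolynomial.map C r) w)
    (hr : r.IsHomogeneous D) (hr0 : r ≠ 0) {κ : B →+* E} (hκ : Function.Injective κ)
    (z x : Fin (n + 1) → E) :
    eval₂Hom κ (fun α => coeff α.1 (linForm z ^ e * linForm x)) w =
      eval z (MvPolynomial.map κ r) ^ e * eval x (MvPolynomial.map κ r) := by
  have hψ := hw.map (eval₂Hom κ fun α => coeff α.1 (linForm z ^ e * linForm x))
  rw [map_eval₂Hom_indetForm _ (isHomogeneous_linForm_pow_mul_linForm e z x),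
    map_eval₂Hom_map_C] at hψ
  exact hψ.eq_of_linForm (hr.map κ) ((map_ne_zero_iff _ (map_injective _ hκ)).2 hr0)

variable [IsDomain B]

theorem IsWedge.scaleVars_eq {w : MvPolynomial (Expo n d) B}
    (hw : IsWedge d D (indetForm B n d) (MvPolynomial.map C r) w) (hr : r.IsHomogeneous D)
    (hr0 : r ≠ 0) :
    scaleVars w = Polynomial.X ^ D * Polynomial.C w := by
  have hform : MvPolynomial.map scaleVars (indetForm B n d) =
      C Polynomial.X * MvPolynomial.map Polynomial.C (indetForm B n d) := by
    refine (map_formOfCoeffs _ _).trans ?_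
    rw [indetForm, ← formOfCoeffs, map_formOfCoeffs, ← formOfCoeffs_const_mul]
    exact congrArg _ (funext fun α => eval₂Hom_X' _ _ _)
  have hcoeff : MvPolynomial.map scaleVars (MvPolynomial.map C r) =
      MvPolynomial.map Polynomial.C (MvPolynomial.map (C : B →+* MvPolynomial (Expo n d) B) r) := by
    rw [scaleVars, map_eval₂Hom_map_C, map_map]
  have hscaled := hw.map scaleVars
  rw [hform, hcoeff] at hscaled
  refine (hw.map Polynomial.C).eq_pow_mul_of_C_mul hscaled
    ((isHomogeneous_indetForm B n d).map _) ((hr.map _).map _) ?_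
  exact (map_ne_zero_iff _ (map_injective _ Polynomial.C_injective)).2
    ((map_ne_zero_iff _ (map_injective _ (C_injective _ _))).2 hr0)

theorem IsWedge.exists_specialization {w : MvPolynomial (Expo n (e + 1)) B}
    (hw : IsWedge (e + 1) D (indetForm B n (e + 1)) (MvPolynomial.map C r) w)
    (hr : r.IsHomogeneous D) (hr0 : r ≠ 0) :
    ∃ ψ : MvPolynomial (Expo n (e + 1)) B →+*
        MvPolynomial (Fin (n + 1)) (MvPolynomial (Fin (n + 1)) B),
      ψ w = C r ^ e * MvPolynomial.map C r ∧ ∀ p, constantCoeff (ψ p) = C (constantCoeff p) := by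
  let κ : B →+* MvPolynomial (Fin (n + 1)) (MvPolynomial (Fin (n + 1)) B) := C.comp C
  have hκ : Function.Injective κ := (C_injective _ _).comp (C_injective _ _)
  have hz : eval (C ∘ X) (MvPolynomial.map κ r) = C r := by
    rw [← map_map, ← map_eval, eval_map]
    exact congrArg C (eval₂_eta r)
  have hx : eval X (MvPolynomial.map κ r) = MvPolynomial.map C r := by
    rw [← map_map, eval_map]
    exact eval₂_eta _
  let φ := eval₂Hom κ fun α : Expo n (e + 1) => coeff α.1 (linForm (C ∘ X) ^ e * linForm X)
  refine ⟨φ, ?_, fun p => ?_⟩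
  · rw [← hz, ← hx]
    exact hw.eval₂Hom_linForm_pow_mul_linForm hr hr0 hκ _ _
  · have hφ : constantCoeff.comp φ = C.comp constantCoeff := by
      refine ringHom_ext (fun b => ?_) fun α => ?_
      · simp [φ, κ]
      · have hzero : constantCoeff ∘ (X : Fin (n + 1) →
            MvPolynomial (Fin (n + 1)) (MvPolynomial (Fin (n + 1)) B)) = 0 :=
          _root_.funext fun j => constantCoeff_X _ j
        simp only [φ, RingHom.comp_apply, eval₂Hom_X', ← coeff_map, map_mul, map_linForm, hzero,
          linForm_zero, mul_zero, coeff_zero, constantCoeff_X, map_zero]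
    exact RingHom.congr_fun hφ p

theorem IsWedge.irreducible {w : MvPolynomial (Expo n (e + 1)) B}
    (hw : IsWedge (e + 1) D (indetForm B n (e + 1)) (MvPolynomial.map C r) w)
    (hr : r.IsHomogeneous D) (hrp : Prime r) (hrC : ∀ a, r ≠ C a) : Irreducible w := by
  obtain ⟨ψ, hψ, hconst⟩ := hw.exists_specialization hr hrp.ne_zero
  have hrp' : Prime (MvPolynomial.map (C : B →+* MvPolynomial (Fin (n + 1)) B) r) :=
    prime_map_C hrp
  have hre : r ^ e ≠ 0 := pow_ne_zero e hrp.ne_zero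
  have hw0 : w ≠ 0 := by
    rintro rfl
    rw [map_zero, ← C_pow] at hψ
    exact mul_ne_zero (C_ne_zero.2 hre) hrp'.ne_zero hψ.symm
  have hdvd : MvPolynomial.map C r ∣ ψ w := Dvd.intro_left _ hψ.symm
  have isUnit_right (p q) (hpq : w = p * q) (hp : MvPolynomial.map C r ∣ ψ p) : IsUnit q := by
    obtain ⟨u, hu⟩ := hp
    have hq : ψ q ∣ C (r ^ e) := by
      rw [hpq, map_mul, hu, mul_assoc, mul_comm (C r ^ e)] at hψ
      rw [C_pow, ← mul_left_cancel₀ hrp'.ne_zero hψ]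
      exact Dvd.intro_left _ rfl
    obtain ⟨b, hb, hqb⟩ := exists_eq_C_of_dvd_C hre hq
    obtain rfl : b = C (constantCoeff q) := by rw [← hconst, hqb, constantCoeff_C]
    have hq0 : constantCoeff q ≠ 0 := fun h0 =>
      ne_zero_of_dvd_ne_zero hre hb (by rw [h0, C_0])
    rw [eq_C_constantCoeff_of_scaleVars_mul (hpq ▸ hw0)
      (hpq ▸ hw.scaleVars_eq hr hrp.ne_zero) hq0]
    exact (isUnit_of_C_dvd_prime_pow hrp hrC hb).map C
  refine ⟨fun hu => hrp'.not_isUnit (isUnit_of_dvd_unit hdvd (hu.map _)), fun p q hpq => ?_⟩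
  rw [hpq, map_mul] at hdvd
  rcases hrp'.dvd_or_dvd hdvd with h | h
  · exact Or.inr (isUnit_right p q hpq h)
  · exact Or.inl (isUnit_right q p (hpq.trans (mul_comm p q)) h)

end IndetForm

attribute [local instance] MvPolynomial.algebraMvPolynomial in
theorem isIntegrallyClosed_mvPolynomial (σ A : Type*) [CommRing A] [IsDomain A]
    [IsIntegrallyClosed A] : IsIntegrallyClosed (MvPolynomial σ A) := by
  let K := FractionRing A
  have hinj : Function.Injective (algebraMap (MvPolynomial σ A) (MvPolynomial σ K)) :=
    map_injective _ (IsFractionRing.injective A K)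
  have : IsIntegrallyClosedIn (MvPolynomial σ A) (MvPolynomial σ K) :=
    isIntegrallyClosedIn_iff.2 ⟨hinj, fun {p} hp => mem_range_map_iff_coeffs_subset.2 (by
      rintro _ hc
      obtain ⟨m, -, rfl⟩ := mem_coeffs_iff.1 hc
      exact IsIntegrallyClosed.isIntegral_iff.1 (isIntegral_iff_isIntegral_coeff.1 hp m))⟩
  exact .of_isIntegrallyClosed_of_isIntegrallyClosedIn _ (MvPolynomial σ K)

section SplitAt

variable {A B ι : Type*} [CommRing A] [CommRing B] (n : ι → ℕ) (i : ι)

theorem splitAt_X_self (j : Fin (n i + 1)) : splitAt (A := A) n i (X ⟨i, j⟩) = X j := by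
  simp [splitAt]

theorem splitAt_X_inclVars (v : Vars (del n i)) :
    splitAt (A := A) n i (X (inclVars n i v)) = C (X v) := by
  simp [splitAt, inclVars, v.1.2]

theorem vars_cases {motive : Vars n → Prop} (self : ∀ j, motive ⟨i, j⟩)
    (incl : ∀ v, motive (inclVars n i v)) (v : Vars n) : motive v := by
  obtain ⟨k, j⟩ := v
  by_cases h : k = i
  · subst h
    exact self j
  · exact incl ⟨⟨k, h⟩, j⟩

/-- `splitAt` as an isomorphism. -/
noncomputable def splitEquiv (A : Type*) [CommRing A] :
    MvPolynomial (Vars n) A ≃ₐ[A] MvPolynomial (Fin (n i + 1)) (MvPolynomial (Vars (del n i)) A) :=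
  AlgEquiv.ofAlgHom (splitAt n i)
    (aevalTower (rename (inclVars n i)) fun j => X ⟨i, j⟩)
    (by ext : 2 <;> simp [splitAt_X_inclVars, splitAt_X_self])
    (by
      ext v : 1
      induction v using vars_cases n i with
      | self j => simp [splitAt_X_self]
      | incl v => simp [splitAt_X_inclVars])

theorem splitAt_map (φ : A →+* B) (R : MvPolynomial (Vars n) A) :
    splitAt n i (map φ R) = map (map φ) (splitAt n i R) := by
  have h : (splitAt n i).toRingHom.comp (map φ) = (map (map φ)).comp (splitAt n i).toRingHom := by
    refine ringHom_ext (fun a => by simp [splitAt]) fun v => ?_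
    induction v using vars_cases n i with
    | self j => simp [splitAt_X_self]
    | incl v => simp [splitAt_X_inclVars]
  exact RingHom.congr_fun h R

theorem mem_range_rename_of_splitAt_eq_C {R : MvPolynomial (Vars n) A}
    {a : MvPolynomial (Vars (del n i)) A} (h : splitAt n i R = C a) :
    R ∈ Set.range (rename (R := A) (inclVars n i)) := by
  refine ⟨a, ?_⟩
  have hC : (splitEquiv n i A).symm (C a) = rename (inclVars n i) a := aevalTower_C _ _ _
  rw [← hC, ← h]
  exact (splitEquiv n i A).symm_apply_apply R

end SplitAt

section CommAlgEquiv

variable {A V τ : Type*} [CommRing A]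

theorem map_commAlgEquiv_map_C_indetForm {n d : ℕ} :
    map (commAlgEquiv A V (Expo n d)).toRingHom (map C (indetForm A n d)) =
      indetForm (MvPolynomial V A) n d := by
  simp [indetForm]

theorem map_commAlgEquiv_map_map_algebraMap {σ : Type*}
    (q : MvPolynomial σ (MvPolynomial V A)) :
    map (commAlgEquiv A V τ).toRingHom (map (map (algebraMap A (MvPolynomial τ A))) q) =
      map C q := by
  rw [map_map]
  congr 1
  ext <;> simp [MvPolynomial.algebraMap_eq]

end CommAlgEquiv

theorem isWedge_wedgeAt {A : Type*} [CommRing A] [IsDomain A] [IsIntegrallyClosed A] {ι : Type*}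
    {n : ι → ℕ} {i : ι} {d D : ℕ} {f : MvPolynomial (Fin (n i + 1)) A}
    {R : MvPolynomial (Vars n) A} (hf : f.IsHomogeneous d) (hs : IsSplittable D (splitAt n i R))
    (hR : R ≠ 0) : IsWedge d D (map C f) (splitAt n i R) (wedgeAt n i d D f R) := by
  have := isIntegrallyClosed_mvPolynomial (Vars (del n i)) A
  have hex : ∃ w, IsWedge d D (map C f) (splitAt n i R) w :=
    exists_isWedge (hf.map C) hs ((map_ne_zero_iff _ (splitEquiv n i A).injective).2 hR)
  rw [wedgeAt, wedge, dif_pos hex]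
  exact hex.choose_spec

end ResultantWedge

open ResultantWedge in
theorem mainTheorem9_general {A : Type*} [CommRing A] [IsDomain A] [IsIntegrallyClosed A]
    {ι : Type*} (n : ι → ℕ) (i : ι) (D : ℕ) (R : MvPolynomial (Vars n) A)
    (hs : IsSplittable D (splitAt n i R)) (hR : Prime R)
    (hi : R ∉ Set.range (rename (R := A) (inclVars n i))) (d : ℕ) (hd : 1 ≤ d) :
    Irreducible (wedgeAt n i d D (indetForm A (n i) d)
      (map (algebraMap A (MvPolynomial (Expo (n i) d) A)) R)) := by
  obtain ⟨e, rfl⟩ := Nat.exists_eq_add_of_le' hd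
  let T := Expo (n i) (e + 1)
  let swap := commAlgEquiv A (Vars (del n i)) T
  have := isIntegrallyClosed_mvPolynomial T A
  have hs' : IsSplittable D (splitAt n i (map (algebraMap A (MvPolynomial T A)) R)) := by
    rw [splitAt_map]
    exact hs.map _
  have hR' : map (algebraMap A (MvPolynomial T A)) R ≠ 0 :=
    (map_ne_zero_iff _ (map_injective _ (C_injective _ _))).2 hR.ne_zero
  have hw := (isWedge_wedgeAt (isHomogeneous_indetForm A (n i) (e + 1)) hs' hR').map
    swap.toRingHom
  rw [map_commAlgEquiv_map_C_indetForm, splitAt_map, map_commAlgEquiv_map_map_algebraMap] at hw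
  have hprime : Prime (splitAt n i R) := (MulEquiv.prime_iff (splitEquiv n i A)).2 hR
  exact (MulEquiv.irreducible_iff swap).1 <| hw.irreducible hs.1 hprime fun a ha =>
    hi (mem_range_rename_of_splitAt_eq_C n i ha)

theorem mainTheorem9 {A : Type*} [CommRing A] [IsDomain A] [UniqueFactorizationMonoid A]
    {ι : Type*} [Finite ι] (n : ι → ℕ) (i : ι) (D : ι → ℕ)
    (R : MvPolynomial (ResultantWedge.Vars n) A)
    (hR : ResultantWedge.IsResultant n D R) (hirr : Irreducible R)
    (hi : R ∉ Set.range (MvPolynomial.rename (R := A) (ResultantWedge.inclVars n i)))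
    (d : ℕ) (hd : 1 ≤ d) :
    Irreducible
      (ResultantWedge.wedgeAt n i d (D i) (ResultantWedge.indetForm A (n i) d)
        (MvPolynomial.map (algebraMap A (MvPolynomial (ResultantWedge.Expo (n i) d) A)) R)) := by
  cases hR with
  | intro _ _ _ hs _ _ => exact mainTheorem9_general n i (D i) R (hs i) hirr.prime hi d hd
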